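/- **Notation.** For $z,c\in\mathbb C$ and $n\in\mathbb N_0$ let $\langle z\rangle_{n,c}=z(z+c)\cdots(z+(n-1)c)$ (with $\langle z\rangle_{0,c}=1$) and $[z]_n=\langle z\rangle_{n,-1}$. Let $\alpha,\beta,r\in\mathbb C$ with $\beta\neq0$. The generalized Stirling numbers $S(n,k,\alpha,\beta,r)$, $0\le k\le n$, are defined by $$\langle z\rangle_{n,-\alpha}=\sum_{k=0}^{n}S(n,k,\alpha,\beta,r)\,\langle z-r\rangle_{k,-\beta}\qquad(z\in\mathbb C),$$ and, for real $\varepsilon$, the generalized Stirling functions at orders $n,k\in\mathbb N_0$ by $$S(n,k,\alpha,\beta,r;\varepsilon)=\frac1{\beta^k k!}\sum_{j=0}^{k}(-1)^j\binom kj e^{(k-j)\varepsilon}\langle r+(k-j)\beta\rangle_{n,-\alpha}.$$ For a sequence $(a_j)$ put $$W(n,j)=\sum\frac{a_1^{k_1}a_2^{k_2}\cdots a_n^{k_n}}{k_1!\,k_2!\cdots k_n!},$$ the sum being over all partitions $1^{k_1}2^{k_2}\cdots n^{k_n}$ of $n$ with exactly $n-j$ parts (an empty sum is $0$; $W(0,0)=1$).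 Fix $m\in\mathbb N_0$, and let $n$ and $\mu$ be natural numbers that vary so that $\mu\to\infty$ and $n=o(\mu^{1/2})$. **Theorem.** *(A) Let $\varepsilon\ne0$, $a_0=(e^\varepsilon-1)/\beta$ and* $$a_j=\frac1{j!\,\beta}\Bigl[e^{\varepsilon}\langle r+\beta\rangle_{j,-\alpha}-\langle r\rangle_{j,-\alpha}\Bigr]\qquad(j\ge1).$$ *Then* $$\frac{\mu!\;S(n,\mu,\alpha,\beta,\mu r;\varepsilon)}{[\mu]_n\,n!}=\Bigl(\frac{\beta}{e^\varepsilon-1}\Bigr)^{n-\mu}\sum_{j=0}^{m}\Bigl(\frac{e^\varepsilon-1}{\beta}\Bigr)^{j}\frac{W(n,j)}{[\mu-n+j]_j}+o\!\left(\Bigl(\frac{\beta}{e^\varepsilon-1}\Bigr)^{n-\mu}\frac{W(n,m)}{[\mu-n+m]_m}\right),$$ *under the nondegeneracy conditions (N) below. If $n$ is fixed, then without condition (N) the difference of the left side and the sum is $\bigl(\frac{\beta}{e^\varepsilon-1}\bigr)^{n-\mu}O(\mu^{-m-1})$ as $\mu\to\infty$.* *(B) Let $\varepsilon=0$ and* $$a_j=\frac1{(j+1)!\,\beta}\Bigl[\langle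 r+\beta\rangle_{j+1,-\alpha}-\langle r\rangle_{j+1,-\alpha}\Bigr]\qquad(j\ge0).$$ *Then* $$\frac{S(n+\mu,\mu,\alpha,\beta,\mu r)}{[\mu]_n\,[n+\mu]_n}=\sum_{j=0}^{m}\frac{W(n,j)}{[\mu-n+j]_j}+o\!\left(\frac{W(n,m)}{[\mu-n+m]_m}\right),$$ *under the nondegeneracy conditions (N) below. If $n$ is fixed, then without condition (N) the difference of the left side and the sum is $O(\mu^{-m-1})$ as $\mu\to\infty$.* *(N), for the respective sequence $(a_j)$: (i) $a_2\ne0$, or $a_j=0$ for all $j\ge2$; and (ii) eventually, for the values of $n$ that occur, $W(n,m)=0$ only if $W(n,j)=0$ for all $j>m$.* *Moreover, in (A) and in (B), if $a_1\ne0$ and $a_2\neq0$, then $W(n,m)\ne0$ for all sufficiently large $n$; so (N) then holds whenever $n\to\infty$.* -/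

import Mathlib

open Filter Asymptotics Finset

/-- The generalized factorial of `z` of order `n` with increment `c`:
`z (z + c) (z + 2 c) ⋯ (z + (n - 1) c)`, with value `1` for `n = 0`. -/
noncomputable def genFactorial (z : ℂ) (n : ℕ) (c : ℂ) : ℂ :=
  ∏ i ∈ range n, (z + (i : ℂ) * c)

/-- The falling factorial `z (z - 1) ⋯ (z - n + 1)`. -/
noncomputable def fallFactorial (z : ℂ) (n : ℕ) : ℂ := genFactorial z n (-1)

theorem genFactorial_succ (z : ℂ) (n : ℕ) (c : ℂ) :
    genFactorial z (n + 1) c = genFactorial z n c * (z + (n : ℂ) * c) := by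
  simp [genFactorial, prod_range_succ]

/-- The Newton-type basis formed by the generalized factorials is linearly independent. -/
theorem genFactorial_independent (β r : ℂ) (N : ℕ) (d : ℕ → ℂ)
    (h : ∀ z : ℂ, ∑ k ∈ range N, d k * genFactorial (z - r) k (-β) = 0) :
    ∀ k < N, d k = 0 := by
  let P : ℕ → Polynomial ℂ :=
    fun k => ∏ i ∈ range k, (Polynomial.X - Polynomial.C (r + (i : ℂ) * β))
  have hdeg : ∀ k, (P k).natDegree = k := by
    intro k
    simp only [P]
    rw [Polynomial.natDegree_prod_of_monic _ _ (fun i _ => Polynomial.monic_X_sub_C _)]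
    simp only [Polynomial.natDegree_X_sub_C, sum_const, card_range, smul_eq_mul, mul_one]
  have hmonic : ∀ k, (P k).Monic := fun k =>
    Polynomial.monic_prod_of_monic _ _ (fun i _ => Polynomial.monic_X_sub_C _)
  have hpoly : ∑ k ∈ range N, Polynomial.C (d k) * P k = 0 := by
    apply Polynomial.funext
    intro z
    rw [Polynomial.eval_finsetSum, Polynomial.eval_zero, ← h z]
    refine sum_congr rfl fun k _ => ?_
    simp only [P, genFactorial, Polynomial.eval_mul, Polynomial.eval_C, Polynomial.eval_prod,
      Polynomial.eval_sub, Polynomial.eval_X]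
    congr 1
    exact prod_congr rfl fun i _ => by ring
  clear h
  induction N with
  | zero => intro k hk; omega
  | succ N ih =>
    have htop : d N = 0 := by
      have hc := congrArg (fun p : Polynomial ℂ => p.coeff N) hpoly
      simp only [Polynomial.finsetSum_coeff, Polynomial.coeff_C_mul, Polynomial.coeff_zero] at hc
      rw [sum_range_succ, sum_eq_zero (fun k hk => by
        rw [Polynomial.coeff_eq_zero_of_natDegree_lt
          (by rw [hdeg]; exact mem_range.1 hk), mul_zero])] at hc
      have h1 : (P N).coeff N = 1 := by
        have := (hmonic N).coeff_natDegree
        rwa [hdeg] at this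
      simpa [h1] using hc
    rw [sum_range_succ, htop, map_zero, zero_mul, add_zero] at hpoly
    intro k hk
    rcases Nat.lt_succ_iff_lt_or_eq.1 hk with h1 | h1
    · exact ih hpoly k h1
    · rw [h1, htop]

/-- Existence and uniqueness of the connection coefficients that define the generalized
Stirling numbers. -/
theorem existsUnique_genStirling (α β r : ℂ) (n : ℕ) :
    ∃! c : ℕ → ℂ, (∀ k, n < k → c k = 0) ∧
      ∀ z : ℂ, genFactorial z n (-α) =
        ∑ k ∈ range (n + 1), c k * genFactorial (z - r) k (-β) := by
  have hex : ∃ c : ℕ → ℂ, (∀ k, n < k → c k = 0) ∧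
      ∀ z : ℂ, genFactorial z n (-α) =
        ∑ k ∈ range (n + 1), c k * genFactorial (z - r) k (-β) := by
    induction n with
    | zero =>
      refine ⟨fun k => if k = 0 then 1 else 0, fun k hk => by simp; omega, fun z => ?_⟩
      simp [genFactorial]
    | succ n ih =>
      obtain ⟨c, hc0, hc⟩ := ih
      refine ⟨fun k => (if k = 0 then 0 else c (k - 1))
        + (r + (k : ℂ) * β - (n : ℂ) * α) * c k, fun k hk => ?_, fun z => ?_⟩
      · have h1 : k ≠ 0 := by omega
        simp [h1, hc0 k (by omega), hc0 (k - 1) (by omega)]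
      · rw [genFactorial_succ, hc z]
        simp only [add_mul, sum_add_distrib]
        rw [sum_range_succ' (fun k => (if k = 0 then 0 else c (k - 1))
              * genFactorial (z - r) k (-β)) (n + 1)]
        rw [sum_range_succ (fun k => (r + (k : ℂ) * β - (n : ℂ) * α) * c k
              * genFactorial (z - r) k (-β)) (n + 1)]
        rw [hc0 (n + 1) (by omega)]
        simp only [Nat.add_eq_zero_iff, one_ne_zero, and_false, if_false, if_true,
          Nat.add_sub_cancel, genFactorial_succ]
        rw [sum_mul, mul_zero, zero_mul, zero_mul, add_zero, add_zero, ← sum_add_distrib]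
        exact sum_congr rfl fun k _ => by ring
  obtain ⟨c, hc0, hc⟩ := hex
  refine ⟨c, ⟨hc0, hc⟩, ?_⟩
  rintro c' ⟨hc0', hc'⟩
  funext k
  by_cases hk : n < k
  · rw [hc0 k hk, hc0' k hk]
  · have := genFactorial_independent β r (n + 1) (fun k => c' k - c k) (fun z => by
      simp only [sub_mul, sum_sub_distrib]
      rw [← hc z, ← hc' z, sub_self]) k (by omega)
    exact sub_eq_zero.1 this

/-- The generalized Stirling number `S(n, k, α, β, r)`: the coefficient of
`⟨z - r⟩_{k,-β}` in the expansion
`⟨z⟩_{n,-α} = ∑_{k = 0}^n S(n, k, α, β, r) ⟨z - r⟩_{k,-β}` (and `0` for `k > n`). -/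
noncomputable def genStirlingNumber (n k : ℕ) (α β r : ℂ) : ℂ :=
  (existsUnique_genStirling α β r n).choose k

/-- The generalized difference operator with exponential factor, of order `k ∈ ℕ`:
`Δ_β^{k,ε} f(z) = ∑_j (-1)^j (k choose j) e^{(k-j) ε} f(z + (k-j) β)`. The binomial
coefficients vanish for `j > k`. -/
noncomputable def genDifference (k : ℕ) (β : ℂ) (ε : ℝ) (f : ℂ → ℂ) (z : ℂ) : ℂ :=
  ∑ j ∈ range (k + 1), (-1) ^ j * (k.choose j : ℂ)
    * Complex.exp (((k : ℂ) - j) * ε) * f (z + ((k : ℂ) - j) * β)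

/-- The generalized Stirling function `S(n, k, α, β, r; ε)` at the orders `n, k ∈ ℕ`:
`(β^k Γ(k + 1))⁻¹ Δ_β^{k,ε} ⟨z⟩_{n,-α}` at `z = r`. -/
noncomputable def genStirlingFunction (n k : ℕ) (α β r : ℂ) (ε : ℝ) : ℂ :=
  genDifference k β ε (fun z => genFactorial z n (-α)) r / (β ^ k * (k.factorial : ℂ))

/-- `W(n, j) = ∑ a₁^{k₁} ⋯ aₙ^{kₙ} / (k₁! ⋯ kₙ!)`, over the partitions
`1^{k₁} 2^{k₂} ⋯ n^{kₙ}` of `n` that have `n - j` parts (an empty sum if `j > n`). -/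
noncomputable def partitionSum (a : ℕ → ℂ) (n j : ℕ) : ℂ :=
  ∑ p : n.Partition with Multiset.card p.parts + j = n,
    ∏ i ∈ Icc 1 n, a i ^ p.parts.count i / ((p.parts.count i).factorial : ℂ)

/-- The sequence `a_j = (e^ε ⟨r + β⟩_{j,-α} - ⟨r⟩_{j,-α}) / (j! β)`;
its value at `j = 0` is `(e^ε - 1) / β`. -/
noncomputable def coeffExp (α β r : ℂ) (ε : ℝ) (j : ℕ) : ℂ :=
  (Complex.exp ε * genFactorial (r + β) j (-α) - genFactorial r j (-α))
    / ((j.factorial : ℂ) * β)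

/-- The sequence `a_j = (⟨r + β⟩_{j+1,-α} - ⟨r⟩_{j+1,-α}) / ((j+1)! β)`. -/
noncomputable def coeffZero (α β r : ℂ) (j : ℕ) : ℂ :=
  (genFactorial (r + β) (j + 1) (-α) - genFactorial r (j + 1) (-α))
    / (((j + 1).factorial : ℂ) * β)

/-- The partial sum `∑_{j = 0}^m q^j W(n, j) / [μ - n + j]_j`. -/
noncomputable def partialExpansion (a : ℕ → ℂ) (q : ℂ) (m n μ : ℕ) : ℂ :=
  ∑ j ∈ range (m + 1), q ^ j * (partitionSum a n j / fallFactorial ((μ : ℂ) - n + j) j)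

/-!
Both expansions are exact identities when all terms are kept; only their truncation is asymptotic.

The exponential generating function of the generalized factorials, `∑_n ⟨z⟩_{n,-α} t^n / n!`, is
multiplicative in `z` (`genFactorialSeries_add`). Hence the `μ`-fold difference at `μ r` is the
`μ`-th power of a first-order difference, and the quantity to be expanded is the coefficient of
`t^n` in `(∑_j a_j t^j)^μ`, divided by `[μ]_n`. For the generalized Stirling numbers this uses
that they are the differences at `ε = 0` (`genStirlingNumber_eq_genStirlingFunction`), and one
power of `t` is split off from each of the `μ` factors. By the multinomial theorem the partition
sums `W(n, j)` are the coefficients of the powers of `∑_{j ≥ 1} a_j t^j`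
(`factorial_mul_partitionSum`), and this gives the expansion with `m = n` as an exact equality for
`n ≤ μ` (`coeff_mk_pow`).

What remains is to bound the terms with `j > m`. Separating the parts equal to `1` from the larger
ones gives, for `a_1 ≠ 0`, a finite formula for `n! W(n, j) / a_1^n`
(`normalized_partitionSum_eq_sum`). It shows that this quantity is at most `(C n^2)^j` for all
`j`, because the `a_j` grow at most geometrically, and that for fixed `j` it is asymptotic to a
nonzero multiple of `n^{2j}` if `a_2 ≠ 0`. So `W(n, m + k) / W(n, m)` is at most a constant times
`(C (n + 1)^2)^k` (`exists_norm_partitionSum_add_le`), whereas the denominators gain a factor of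
at least `(μ - n)^k`. The discarded terms are dominated by a geometric series with ratio
`O((n + 1)^2 / (μ - n))`, which tends to `0` since `n = o(√μ)`. In the degenerate cases nothing has to be
estimated: if `a_j = 0` for all `j ≥ 2`, then `W(n, j) = 0` for `j > 0`; if `a_1 = 0`, then
`W(n, m) = 0` for `n > 2 m`, and the discarded terms vanish by hypothesis.
-/

/-! ### Generating functions of generalized factorials and finite differences -/

/-- Vandermonde's convolution for generalized factorials. -/
theorem genFactorial_add (x y c : ℂ) (n : ℕ) :
    genFactorial (x + y) n c = ∑ p ∈ antidiagonal n,
      (n.choose p.1 : ℂ) * (genFactorial x p.1 c * genFactorial y p.2 c) := by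
  induction n with
  | zero => simp [genFactorial]
  | succ n ih =>
    rw [sum_antidiagonal_choose_succ_mul (fun i j => genFactorial x i c * genFactorial y j c),
      genFactorial_succ, ih, sum_mul, ← sum_add_distrib]
    refine sum_congr rfl fun p hp => ?_
    have hp := mem_antidiagonal.1 hp
    rw [Nat.choose_symm_of_eq_add (show n = p.2 + p.1 by omega), genFactorial_succ,
      genFactorial_succ, ← hp]
    push_cast
    ring

/-- The exponential generating function of the generalized factorials of `z` with increment `c`,
that is, the binomial series `(1 - c t)^{-z / c}`, or `exp (z t)` if `c = 0`. -/
noncomputable def genFactorialSeries (c z : ℂ) : PowerSeries ℂ :=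
  PowerSeries.mk fun n => genFactorial z n c / (n.factorial : ℂ)

theorem genFactorialSeries_add (c x y : ℂ) :
    genFactorialSeries c (x + y) = genFactorialSeries c x * genFactorialSeries c y := by
  ext n
  rw [PowerSeries.coeff_mul, genFactorialSeries, PowerSeries.coeff_mk, genFactorial_add, sum_div]
  refine sum_congr rfl fun p hp => ?_
  have hp := mem_antidiagonal.1 hp
  rw [genFactorialSeries, genFactorialSeries, PowerSeries.coeff_mk, PowerSeries.coeff_mk, ← hp,
    Nat.cast_add_choose]
  have h1 : (p.1.factorial : ℂ) ≠ 0 := Nat.cast_ne_zero.2 (Nat.factorial_ne_zero _)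
  have h2 : (p.2.factorial : ℂ) ≠ 0 := Nat.cast_ne_zero.2 (Nat.factorial_ne_zero _)
  have h3 : ((p.1 + p.2).factorial : ℂ) ≠ 0 := Nat.cast_ne_zero.2 (Nat.factorial_ne_zero _)
  field_simp

theorem genFactorialSeries_zero (c : ℂ) : genFactorialSeries c 0 = 1 := by
  ext n
  rw [genFactorialSeries, PowerSeries.coeff_mk, PowerSeries.coeff_one]
  cases n with
  | zero => simp [genFactorial]
  | succ n => simp [genFactorial, prod_range_succ']

theorem genFactorialSeries_natCast_mul (c z : ℂ) (k : ℕ) :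
    genFactorialSeries c (k * z) = genFactorialSeries c z ^ k := by
  induction k with
  | zero => simp [genFactorialSeries_zero]
  | succ k ih => rw [Nat.cast_succ, add_mul, one_mul, genFactorialSeries_add, ih, pow_succ]

/-- The difference operator of order `k`, applied at `k r` to the generalized factorials, acts on
generating functions as the `k`-th power of a first-order difference. -/
theorem genDifference_genFactorial (c β r : ℂ) (ε : ℝ) (k n : ℕ) :
    genDifference k β ε (fun z => genFactorial z n c) (k * r) = (n.factorial : ℂ) *
      PowerSeries.coeff n ((PowerSeries.C (Complex.exp ε) * genFactorialSeries c (r + β)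
        - genFactorialSeries c r) ^ k) := by
  have hn : (n.factorial : ℂ) ≠ 0 := Nat.cast_ne_zero.2 (Nat.factorial_ne_zero _)
  rw [sub_eq_neg_add, add_pow, map_sum, genDifference, mul_sum]
  refine sum_congr rfl fun j hj => ?_
  have hj : j ≤ k := Nat.lt_succ_iff.1 (mem_range.1 hj)
  have hz : (k : ℂ) * r + ((k : ℂ) - j) * β = (j : ℂ) * r + ((k - j : ℕ) : ℂ) * (r + β) := by
    push_cast [hj]; ring
  have he : Complex.exp (((k : ℂ) - j) * ε) = Complex.exp ε ^ (k - j) := by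
    rw [← Complex.exp_nat_mul]; push_cast [hj]; rfl
  have hp : (-genFactorialSeries c r) ^ j * (PowerSeries.C (Complex.exp ε)
      * genFactorialSeries c (r + β)) ^ (k - j) * (k.choose j : PowerSeries ℂ)
      = PowerSeries.C ((-1) ^ j * (k.choose j : ℂ) * Complex.exp ε ^ (k - j)) *
        genFactorialSeries c ((k : ℂ) * r + ((k : ℂ) - j) * β) := by
    rw [hz, genFactorialSeries_add _ (j * r), genFactorialSeries_natCast_mul,
      genFactorialSeries_natCast_mul,
      neg_pow, mul_pow]
    simp only [map_mul, map_pow, map_neg, map_one, map_natCast]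
    ring
  rw [hp, PowerSeries.coeff_C_mul, genFactorialSeries, PowerSeries.coeff_mk, he]
  field_simp

/-- Finite differences of generalized factorials with the increment of the step. -/
theorem genDifference_genFactorial_neg (β r : ℂ) (k n : ℕ) :
    genDifference k β 0 (fun z => genFactorial (z - r) n (-β)) r
      = if n = k then β ^ k * (k.factorial : ℂ) else 0 := by
  have h := genDifference_genFactorial (-β) β 0 0 k n
  have hs : genFactorialSeries (-β) β = 1 + PowerSeries.C β * PowerSeries.X := by
    ext i
    rw [genFactorialSeries, PowerSeries.coeff_mk]
    match i with
    | 0 => simp [genFactorial]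
    | 1 => simp [genFactorial]
    | i + 2 =>
      rw [genFactorial, prod_eq_zero (i := 1) (by simp) (by simp)]
      simp [PowerSeries.coeff_one]
  rw [zero_add, hs, genFactorialSeries_zero] at h
  simp only [Complex.ofReal_zero, Complex.exp_zero, map_one, one_mul, add_sub_cancel_left,
    mul_pow, ← map_pow, PowerSeries.coeff_C_mul, PowerSeries.coeff_X_pow] at h
  have : genDifference k β 0 (fun z => genFactorial (z - r) n (-β)) r
      = genDifference k β 0 (fun z => genFactorial z n (-β)) (k * 0) := by
    simp only [genDifference, mul_zero, zero_add, add_sub_cancel_left]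
  rw [this, h]
  split_ifs with hnk
  · subst hnk; ring
  · simp

/-- The generalized Stirling numbers are the generalized Stirling functions at `ε = 0`. -/
theorem genStirlingNumber_eq_genStirlingFunction (n k : ℕ) (α r : ℂ) {β : ℂ} (hβ : β ≠ 0)
    (hk : k ≤ n) : genStirlingNumber n k α β r = genStirlingFunction n k α β r 0 := by
  have h := (existsUnique_genStirling α β r n).choose_spec.1.2
  change ∀ z, _ = ∑ l ∈ range (n + 1), genStirlingNumber n l α β r * _ at h
  have hk' : β ^ k * (k.factorial : ℂ) ≠ 0 :=
    mul_ne_zero (pow_ne_zero _ hβ) (Nat.cast_ne_zero.2 (Nat.factorial_ne_zero _))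
  have hlin : genDifference k β 0 (fun z => genFactorial z n (-α)) r
      = ∑ l ∈ range (n + 1), genStirlingNumber n l α β r
        * genDifference k β 0 (fun z => genFactorial (z - r) l (-β)) r := by
    simp only [genDifference, h, mul_sum]
    rw [sum_comm]
    exact sum_congr rfl fun l _ => sum_congr rfl fun j _ => by ring
  rw [genStirlingFunction, eq_div_iff hk', hlin]
  simp only [genDifference_genFactorial_neg, mul_ite, mul_zero, sum_ite_eq', mem_range]
  rw [if_pos (by omega)]

/-! ### Partition sums as coefficients of powers of a series -/

theorem PowerSeries.coeff_pow_congr {f g : PowerSeries ℂ} {n : ℕ}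
    (h : ∀ i ≤ n, PowerSeries.coeff i f = PowerSeries.coeff i g) (s : ℕ) :
    PowerSeries.coeff n (f ^ s) = PowerSeries.coeff n (g ^ s) := by
  have h1 : PowerSeries.X ^ (n + 1) ∣ f - g := by
    rw [PowerSeries.X_pow_dvd_iff]
    intro i hi
    rw [map_sub, h i (by omega), sub_self]
  have h2 := (PowerSeries.X_pow_dvd_iff.1 (h1.trans (sub_dvd_pow_sub_pow f g s))) n (by omega)
  rwa [map_sub, sub_eq_zero] at h2

theorem Multiset.prod_map_C_mul_X_pow (a : ℕ → ℂ) (k : Multiset ℕ) :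
    (k.map fun i => PowerSeries.C (a i) * PowerSeries.X ^ i).prod
      = PowerSeries.C (k.map a).prod * PowerSeries.X ^ k.sum := by
  induction k using Multiset.induction with
  | empty => simp
  | cons i k ih =>
    simp only [Multiset.map_cons, Multiset.prod_cons, Multiset.sum_cons, ih, map_mul, pow_add]
    ring

theorem Multiset.factorial_card_eq_prod_mul_countPerms {k : Multiset ℕ} {t : Finset ℕ}
    (h : k.toFinset ⊆ t) :
    (∏ i ∈ t, (k.count i).factorial) * k.countPerms = k.card.factorial := by
  have h1 : k.countPerms = Nat.multinomial t (fun i => k.count i) := by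
    rw [Multiset.countPerms, Finsupp.multinomial_eq_of_support_subset (s := t) (by simpa using h)]
    rfl
  rw [h1, Nat.multinomial_spec, Multiset.sum_count_eq_card (fun i hi => h (by simpa using hi))]

/-- The generating function of the partition sums: the partitions of `n` into exactly `s` parts
are the monomials of total degree `n` in the multinomial expansion of an `s`-th power. -/
theorem factorial_mul_partitionSum (a : ℕ → ℂ) {n s j : ℕ} (hs : s + j = n) :
    (s.factorial : ℂ) * partitionSum a n j
      = PowerSeries.coeff n ((PowerSeries.mk fun i => if i = 0 then 0 else a i) ^ s) := by
  rw [PowerSeries.coeff_pow_congr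
    (g := ∑ i ∈ Icc 1 n, PowerSeries.C (a i) * PowerSeries.X ^ i), Finset.sum_pow, map_sum,
    partitionSum, mul_sum]
  swap
  · intro i hi
    simp only [PowerSeries.coeff_mk, map_sum, PowerSeries.coeff_C_mul, PowerSeries.coeff_X_pow,
      mul_ite, mul_one, mul_zero, sum_ite_eq, mem_Icc]
    split_ifs <;> first | rfl | omega
  have key : ∀ k : Sym ℕ s, PowerSeries.coeff n ((k.1.countPerms : PowerSeries ℂ) *
      (k.1.map fun i => PowerSeries.C (a i) * PowerSeries.X ^ i).prod)
      = if k.1.sum = n then (k.1.countPerms : ℂ) * (k.1.map a).prod else 0 := by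
    intro k
    rw [Multiset.prod_map_C_mul_X_pow, ← map_natCast (PowerSeries.C (R := ℂ)),
      PowerSeries.coeff_C_mul, PowerSeries.coeff_C_mul, PowerSeries.coeff_X_pow]
    rw [mul_ite, mul_one, mul_zero, mul_ite, mul_zero]
    exact if_congr eq_comm rfl rfl
  rw [sum_congr rfl fun k _ => key k, ← sum_filter]
  refine sum_bij' (fun p hp => ⟨p.parts, by have := (mem_filter.1 hp).2; omega⟩)
    (fun k hk => ⟨k.1, fun {i} hi => ?_, (mem_filter.1 hk).2⟩) ?_ ?_ ?_ ?_ ?_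
  · exact (mem_Icc.1 (mem_sym_iff.1 (mem_filter.1 hk).1 i hi)).1
  · intro p hp
    refine mem_filter.2 ⟨mem_sym_iff.2 fun i hi => mem_Icc.2 ⟨p.parts_pos hi, ?_⟩, p.parts_sum⟩
    exact (Multiset.le_sum_of_mem hi).trans_eq p.parts_sum
  · intro k hk
    refine mem_filter.2 ⟨mem_univ _, ?_⟩
    change Multiset.card k.1 + j = n
    rw [k.2, hs]
  · intro p _
    rfl
  · intro k _
    rfl
  · intro p hp
    have hsub : p.parts.toFinset ⊆ Icc 1 n := fun i hi => by
      have hi := Multiset.mem_toFinset.1 hi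
      exact mem_Icc.2 ⟨p.parts_pos hi, (Multiset.le_sum_of_mem hi).trans_eq p.parts_sum⟩
    have hcard : p.parts.card = s := by have := (mem_filter.1 hp).2; omega
    have h1 := Multiset.factorial_card_eq_prod_mul_countPerms hsub
    have h2 : (p.parts.map a).prod = ∏ i ∈ Icc 1 n, a i ^ p.parts.count i := by
      rw [prod_multiset_map_count]
      refine prod_subset hsub fun i _ hi => ?_
      rw [Multiset.count_eq_zero_of_notMem (fun h => hi (Multiset.mem_toFinset.2 h)), pow_zero]
    have h3 : (∏ i ∈ Icc 1 n, ((p.parts.count i).factorial : ℂ)) ≠ 0 :=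
      prod_ne_zero_iff.2 fun i _ => Nat.cast_ne_zero.2 (Nat.factorial_ne_zero _)
    change _ = (p.parts.countPerms : ℂ) * (p.parts.map a).prod
    rw [h2, prod_div_distrib, ← hcard, ← h1, Nat.cast_mul, Nat.cast_prod]
    field_simp

theorem partitionSum_eq_zero_of_lt (a : ℕ → ℂ) {n j : ℕ} (h : n < j) : partitionSum a n j = 0 := by
  rw [partitionSum, filter_eq_empty_iff.2 (fun p _ => by omega), sum_empty]

/-- Writing `∑_{i ≥ 1} a_i t^i = t (a_1 + E(t))`, the partition sums are expressed through the
powers of the series `E` without constant term, that is, by the number `k` of parts larger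
than `1`. -/
theorem partitionSum_eq_sum (a : ℕ → ℂ) (s j : ℕ) :
    partitionSum a (s + j) j = ∑ k ∈ range (s + 1),
      a 1 ^ (s - k) / (((s - k).factorial : ℂ) * (k.factorial : ℂ)) *
      PowerSeries.coeff j ((PowerSeries.mk fun i => if i = 0 then 0 else a (i + 1)) ^ k) := by
  set E : PowerSeries ℂ := PowerSeries.mk fun i => if i = 0 then 0 else a (i + 1) with hE
  have hB : (PowerSeries.mk fun i => if i = 0 then 0 else a i)
      = PowerSeries.X * (E + PowerSeries.C (a 1)) := by
    ext i
    cases i with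
    | zero => simp
    | succ i =>
      rw [PowerSeries.coeff_succ_X_mul]
      cases i with
      | zero => simp [hE]
      | succ i => simp [hE]
  have hs : (s.factorial : ℂ) ≠ 0 := Nat.cast_ne_zero.2 (Nat.factorial_ne_zero _)
  have h := factorial_mul_partitionSum a (n := s + j) (s := s) (j := j) rfl
  rw [hB, mul_pow, add_comm s j, PowerSeries.coeff_X_pow_mul, add_pow, map_sum] at h
  rw [add_comm s j, ← mul_right_inj' hs, h, mul_sum]
  refine sum_congr rfl fun k hk => ?_
  have hk : k ≤ s := Nat.lt_succ_iff.1 (mem_range.1 hk)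
  rw [← map_pow, ← map_natCast (PowerSeries.C (R := ℂ)), mul_assoc, ← map_mul,
    PowerSeries.coeff_mul_C, Nat.cast_choose ℂ hk]
  have h1 : (k.factorial : ℂ) ≠ 0 := Nat.cast_ne_zero.2 (Nat.factorial_ne_zero _)
  have h2 : ((s - k).factorial : ℂ) ≠ 0 := Nat.cast_ne_zero.2 (Nat.factorial_ne_zero _)
  field_simp

/-- The number `k` of parts larger than `1` runs up to `j` only; the bound `j + k ≤ n` is enforced
by the falling factorial, so that the formula holds for all `n` and `j`. -/
theorem factorial_mul_partitionSum_eq_sum (a : ℕ → ℂ) (n j : ℕ) :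
    (n.factorial : ℂ) * partitionSum a n j = ∑ k ∈ range (j + 1),
      (n.descFactorial (j + k) : ℂ) * a 1 ^ (n - (j + k)) / (k.factorial : ℂ) *
      PowerSeries.coeff j ((PowerSeries.mk fun i => if i = 0 then 0 else a (i + 1)) ^ k) := by
  set E : PowerSeries ℂ := PowerSeries.mk fun i => if i = 0 then 0 else a (i + 1) with hE
  rcases lt_or_ge n j with hnj | hnj
  · rw [partitionSum_eq_zero_of_lt a hnj, mul_zero, sum_eq_zero]
    intro k _
    rw [Nat.descFactorial_of_lt (by omega)]
    simp
  obtain ⟨s, rfl⟩ := Nat.exists_eq_add_of_le' hnj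
  have hX : PowerSeries.X ∣ E := by
    rw [PowerSeries.X_dvd_iff]
    simp [hE]
  rw [partitionSum_eq_sum, ← hE, mul_sum]
  rw [← sum_subset (s₁ := range (min s j + 1)) (s₂ := range (s + 1)),
    ← sum_subset (s₁ := range (min s j + 1)) (s₂ := range (j + 1))]
  · refine sum_congr rfl fun k hk => ?_
    have hk : k ≤ min s j := Nat.lt_succ_iff.1 (mem_range.1 hk)
    have hks : k ≤ s := hk.trans (min_le_left _ _)
    have hsub : s + j - (j + k) = s - k := by omega
    have h1 := Nat.factorial_mul_descFactorial (show j + k ≤ s + j by omega)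
    rw [hsub] at h1 ⊢
    rw [← h1]
    have h2 : ((s - k).factorial : ℂ) ≠ 0 := Nat.cast_ne_zero.2 (Nat.factorial_ne_zero _)
    push_cast
    field_simp
  · exact range_subset_range.2 (by omega)
  · intro k hk hk'
    have hk := mem_range.1 hk
    have hk' : ¬ k < min s j + 1 := fun h => hk' (mem_range.2 h)
    rw [Nat.descFactorial_of_lt (by omega)]
    simp
  · exact range_subset_range.2 (by omega)
  · intro k hk hk'
    have hk := mem_range.1 hk
    have hk' : ¬ k < min s j + 1 := fun h => hk' (mem_range.2 h)
    rw [PowerSeries.X_pow_dvd_iff.1 (pow_dvd_pow_of_dvd hX k) j (by omega), mul_zero, mul_zero]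

theorem partitionSum_eq_zero_of_one_eq_zero {a : ℕ → ℂ} (ha : a 1 = 0) {n j : ℕ} (h : 2 * j < n) :
    partitionSum a n j = 0 := by
  have h1 := factorial_mul_partitionSum_eq_sum a n j
  rw [sum_eq_zero] at h1
  · exact (mul_eq_zero.1 h1).resolve_left (Nat.cast_ne_zero.2 (Nat.factorial_ne_zero _))
  · intro k hk
    have := mem_range.1 hk
    rw [ha, zero_pow (by omega)]
    simp

theorem partitionSum_eq_zero_of_forall_eq_zero {a : ℕ → ℂ} (ha : ∀ j ≥ 2, a j = 0) (n : ℕ) {j : ℕ}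
    (hj : j ≠ 0) : partitionSum a n j = 0 := by
  have h1 := factorial_mul_partitionSum_eq_sum a n j
  have hE : (PowerSeries.mk fun i => if i = 0 then 0 else a (i + 1)) = 0 := by
    ext i
    rcases eq_or_ne i 0 with hi | hi
    · simp [hi]
    · simp [hi, ha (i + 1) (by omega)]
  rw [hE, sum_eq_zero] at h1
  · exact (mul_eq_zero.1 h1).resolve_left (Nat.cast_ne_zero.2 (Nat.factorial_ne_zero _))
  · intro k _
    rcases eq_or_ne k 0 with hk | hk
    · simp [hk, PowerSeries.coeff_one, hj]
    · simp [zero_pow hk]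

theorem normalized_partitionSum_eq_sum {a : ℕ → ℂ} (ha : a 1 ≠ 0) (n j : ℕ) :
    (n.factorial : ℂ) * partitionSum a n j / a 1 ^ n = ∑ k ∈ range (j + 1),
      (n.descFactorial (j + k) : ℂ) * ((a 1)⁻¹ ^ (j + k) / (k.factorial : ℂ) *
      PowerSeries.coeff j ((PowerSeries.mk fun i => if i = 0 then 0 else a (i + 1)) ^ k)) := by
  rw [factorial_mul_partitionSum_eq_sum, sum_div]
  refine sum_congr rfl fun k _ => ?_
  rcases lt_or_ge n (j + k) with h | h
  · rw [Nat.descFactorial_of_lt h]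
    simp
  · have : a 1 ^ n = a 1 ^ (n - (j + k)) * a 1 ^ (j + k) := by
      rw [← pow_add, Nat.sub_add_cancel h]
    rw [this, inv_pow]
    field_simp

/-! ### Growth of the partition sums -/

/-- Geometric bounds on the coefficients of a series without constant term carry over to its
powers, uniformly in the exponent. -/
theorem norm_coeff_pow_le {f : PowerSeries ℂ} {K : ℝ} (hK : 0 ≤ K)
    (h0 : PowerSeries.coeff 0 f = 0) (h : ∀ i ≥ 1, ‖PowerSeries.coeff i f‖ ≤ K ^ i) (k j : ℕ) :
    ‖PowerSeries.coeff j (f ^ k)‖ ≤ (2 * K) ^ j := by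
  induction k generalizing j with
  | zero =>
    rw [pow_zero, PowerSeries.coeff_one]
    split_ifs with hj
    · simp [hj]
    · rw [norm_zero]; positivity
  | succ k ih =>
    -- The factor `2` in the bound pays for the convolution: `K^i (2K)^(j-i) = (2K)^j 2^(-i)`.
    have hsum : ∀ j : ℕ, ∑ i ∈ range j, ((2 : ℝ)⁻¹) ^ (i + 1) ≤ 1 := fun j => by
      have : ∑ i ∈ range j, ((2 : ℝ)⁻¹) ^ (i + 1) = 1 - 2⁻¹ ^ j := by
        induction j with
        | zero => simp
        | succ j ihj => rw [sum_range_succ, ihj]; ring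
      rw [this]
      have : (0 : ℝ) ≤ 2⁻¹ ^ j := by positivity
      linarith
    rw [pow_succ', PowerSeries.coeff_mul, Nat.sum_antidiagonal_eq_sum_range_succ_mk,
      sum_range_succ', h0, zero_mul, add_zero]
    calc ‖∑ i ∈ range j, PowerSeries.coeff (i + 1) f * PowerSeries.coeff (j - (i + 1)) (f ^ k)‖
        ≤ ∑ i ∈ range j, (2 * K) ^ j * (2⁻¹) ^ (i + 1) := by
          refine norm_sum_le_of_le _ fun i hi => ?_
          rw [norm_mul]
          have hi : i + 1 ≤ j := mem_range.1 hi
          calc _ ≤ K ^ (i + 1) * (2 * K) ^ (j - (i + 1)) :=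
                mul_le_mul (h _ (by omega)) (ih _) (norm_nonneg _) (by positivity)
            _ = (2 * K) ^ (i + 1) * (2 * K) ^ (j - (i + 1)) * (2⁻¹) ^ (i + 1) := by
                rw [mul_pow 2 K (i + 1), inv_pow]; field_simp
            _ = _ := by rw [← pow_add, Nat.add_sub_cancel' hi]
      _ ≤ _ := by
          rw [← mul_sum]
          exact mul_le_of_le_one_right (by positivity) (hsum j)

theorem exists_norm_partitionSum_le {a : ℕ → ℂ} (ha : a 1 ≠ 0) {K : ℝ} (hK0 : 0 ≤ K)
    (hK : ∀ i ≥ 1, ‖a (i + 1)‖ ≤ K ^ i) :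
    ∃ C : ℝ, 1 ≤ C ∧ ∀ n ≥ 1, ∀ j, ‖(n.factorial : ℂ) * partitionSum a n j / a 1 ^ n‖
      ≤ (C * (n : ℝ) ^ 2) ^ j := by
  set P : ℝ := max 1 ‖(a 1)⁻¹‖ with hP
  have hP1 : 1 ≤ P := le_max_left _ _
  refine ⟨max 1 (2 * (P ^ 2 * (2 * K))), le_max_left _ _, fun n hn j => ?_⟩
  have hn1 : (1 : ℝ) ≤ n := by exact_mod_cast hn
  have hterm : ∀ k ∈ range (j + 1), ‖(n.descFactorial (j + k) : ℂ) *
      ((a 1)⁻¹ ^ (j + k) / (k.factorial : ℂ) *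
      PowerSeries.coeff j ((PowerSeries.mk fun i => if i = 0 then 0 else a (i + 1)) ^ k))‖
      ≤ (n : ℝ) ^ (2 * j) * (P ^ (2 * j) * (2 * K) ^ j) := by
    intro k hk
    have hk : k ≤ j := Nat.lt_succ_iff.1 (mem_range.1 hk)
    rw [norm_mul, norm_mul, norm_div, norm_pow, Complex.norm_natCast, Complex.norm_natCast]
    have h1 : (n.descFactorial (j + k) : ℝ) ≤ (n : ℝ) ^ (2 * j) :=
      (by exact_mod_cast Nat.descFactorial_le_pow n (j + k) :
        (n.descFactorial (j + k) : ℝ) ≤ (n : ℝ) ^ (j + k)).trans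
        (pow_le_pow_right₀ hn1 (by omega))
    have h2 : ‖(a 1)⁻¹‖ ^ (j + k) / (k.factorial : ℝ) ≤ P ^ (2 * j) := by
      have hfac : (1 : ℝ) ≤ k.factorial := by exact_mod_cast Nat.factorial_pos k
      refine (div_le_self (by positivity) hfac).trans ?_
      exact (pow_le_pow_left₀ (norm_nonneg _) (le_max_right _ _) _).trans
        (pow_le_pow_right₀ hP1 (by omega))
    have h3 := norm_coeff_pow_le (f := PowerSeries.mk fun i => if i = 0 then 0 else a (i + 1))
      hK0 (by simp) (fun i hi => by simpa [show i ≠ 0 by omega] using hK i hi) k j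
    gcongr
  rw [normalized_partitionSum_eq_sum ha]
  refine (norm_sum_le_of_le _ hterm).trans ?_
  rw [sum_const, card_range, nsmul_eq_mul]
  -- The number of summands is absorbed into the constant.
  have h2 : ((j + 1 : ℕ) : ℝ) ≤ 2 ^ j := by exact_mod_cast Nat.lt_two_pow_self
  calc _ ≤ (2 : ℝ) ^ j * ((n : ℝ) ^ (2 * j) * (P ^ (2 * j) * (2 * K) ^ j)) := by gcongr
    _ = (2 * (P ^ 2 * (2 * K)) * (n : ℝ) ^ 2) ^ j := by
        simp only [mul_pow, pow_mul]; ring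
    _ ≤ _ := by
        gcongr
        exact le_max_right _ _

/-- For fixed `j` and large `n`, the partitions with `j` parts equal to `2` and all others equal to
`1` dominate. -/
theorem tendsto_normalized_partitionSum {a : ℕ → ℂ} (ha : a 1 ≠ 0) (j : ℕ) :
    Tendsto (fun n : ℕ => (n.factorial : ℂ) * partitionSum a n j / a 1 ^ n / (n : ℂ) ^ (2 * j))
      atTop (nhds ((a 1)⁻¹ ^ (2 * j) / (j.factorial : ℂ) * a 2 ^ j)) := by
  have hself : ∀ p : ℕ, Tendsto (fun n : ℕ => (n.descFactorial p : ℂ) / (n : ℂ) ^ p) atTop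
      (nhds 1) := by
    intro p
    have h := isEquivalent_descFactorial p
    have h1 := (isEquivalent_iff_tendsto_one (by
      filter_upwards [eventually_ge_atTop 1] with n hn
      have : (n : ℝ) ≠ 0 := by positivity
      positivity)).1 h
    have h2 := (Complex.continuous_ofReal.tendsto 1).comp h1
    refine (Complex.ofReal_one ▸ h2).congr fun n => ?_
    simp
  have hlt : ∀ p q : ℕ, p < q → Tendsto (fun n : ℕ => (n.descFactorial p : ℂ) / (n : ℂ) ^ q) atTop
      (nhds 0) := by
    intro p q hpq
    have h0 : Tendsto (fun n : ℕ => ((n : ℂ)⁻¹) ^ (q - p)) atTop (nhds 0) := by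
      have := (tendsto_inv_atTop_nhds_zero_nat (𝕜 := ℂ)).pow (q - p)
      rwa [zero_pow (by omega)] at this
    have := (hself p).mul h0
    rw [mul_zero] at this
    refine this.congr fun n => ?_
    rw [inv_pow, div_mul_eq_mul_div, ← div_eq_mul_inv, div_div, ← pow_add,
      Nat.sub_add_cancel hpq.le]
  set c : ℕ → ℂ := fun k => (a 1)⁻¹ ^ (j + k) / (k.factorial : ℂ) *
      PowerSeries.coeff j ((PowerSeries.mk fun i => if i = 0 then 0 else a (i + 1)) ^ k) with hc
  -- Only `k = j` contributes in the limit, and `t ^ j` has the coefficient `a_2 ^ j` in `E ^ j`.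
  have hcj : c j = (a 1)⁻¹ ^ (2 * j) / (j.factorial : ℂ) * a 2 ^ j := by
    have hE : (PowerSeries.mk fun i => if i = 0 then 0 else a (i + 1))
        = PowerSeries.X * PowerSeries.mk fun i => a (i + 2) := by
      ext i
      cases i <;> simp [PowerSeries.coeff_succ_X_mul]
    simp only [hc]
    rw [hE, mul_pow, PowerSeries.coeff_X_pow_mul', if_pos le_rfl, Nat.sub_self,
      PowerSeries.coeff_zero_eq_constantCoeff_apply, map_pow, two_mul]
    simp [← PowerSeries.coeff_zero_eq_constantCoeff_apply]
  have hsum : Tendsto (fun n : ℕ => ∑ k ∈ range (j + 1),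
      (n.descFactorial (j + k) : ℂ) / (n : ℂ) ^ (2 * j) * c k) atTop
      (nhds (∑ k ∈ range (j + 1), (if k = j then 1 else 0) * c k)) := by
    refine tendsto_finsetSum _ fun k hk => Tendsto.mul_const _ ?_
    have hk := mem_range.1 hk
    split_ifs with hkj
    · subst hkj
      rw [← two_mul]
      exact hself _
    · exact hlt _ _ (by omega)
  simp only [ite_mul, one_mul, zero_mul, sum_ite_eq', mem_range, Nat.lt_succ_self, if_true,
    hcj] at hsum
  refine hsum.congr fun n => ?_
  rw [normalized_partitionSum_eq_sum ha, sum_div]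
  exact sum_congr rfl fun k _ => by ring

theorem exists_le_norm_normalized_partitionSum {a : ℕ → ℂ} (ha1 : a 1 ≠ 0) (ha2 : a 2 ≠ 0)
    (m : ℕ) :
    ∃ c : ℝ, 0 < c ∧ ∀ᶠ n : ℕ in atTop,
      c * ((n : ℝ) ^ 2) ^ m ≤ ‖(n.factorial : ℂ) * partitionSum a n m / a 1 ^ n‖ := by
  have h := (tendsto_normalized_partitionSum ha1 m).norm
  set L : ℂ := (a 1)⁻¹ ^ (2 * m) / (m.factorial : ℂ) * a 2 ^ m with hL
  have hL0 : 0 < ‖L‖ := norm_pos_iff.2 (mul_ne_zero (div_ne_zero (pow_ne_zero _ (inv_ne_zero ha1))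
    (Nat.cast_ne_zero.2 (Nat.factorial_ne_zero _))) (pow_ne_zero _ ha2))
  refine ⟨‖L‖ / 2, by positivity, ?_⟩
  filter_upwards [h.eventually_const_lt (half_lt_self hL0), eventually_ge_atTop 1] with n hn hn1
  have hn0 : (0 : ℝ) < n := by exact_mod_cast hn1
  rw [norm_div _ ((n : ℂ) ^ (2 * m)), norm_pow, Complex.norm_natCast, lt_div_iff₀ (by positivity),
    pow_mul] at hn
  exact hn.le

theorem eventually_partitionSum_ne_zero {a : ℕ → ℂ} (ha1 : a 1 ≠ 0) (ha2 : a 2 ≠ 0) (m : ℕ) :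
    ∀ᶠ n in atTop, partitionSum a n m ≠ 0 := by
  obtain ⟨c, hc, h⟩ := exists_le_norm_normalized_partitionSum ha1 ha2 m
  filter_upwards [h, eventually_ge_atTop 1] with n hn hn1 h0
  have hn0 : (0 : ℝ) < n := by exact_mod_cast hn1
  rw [h0, mul_zero, zero_div, norm_zero] at hn
  have : 0 < c * ((n : ℝ) ^ 2) ^ m := by positivity
  linarith

/-- Successive partition sums grow by a factor `O(n ^ 2)` at most, wherever the first of them does
not vanish. For large `n` this compares the upper and the lower bound of the normalized partition
sums; finitely many `n` are absorbed into the constant. -/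
theorem exists_norm_partitionSum_add_le {a : ℕ → ℂ} {K : ℝ} (hK0 : 0 ≤ K)
    (hK : ∀ i ≥ 1, ‖a (i + 1)‖ ≤ K ^ i) (ha : a 2 = 0 → ∀ j ≥ 2, a j = 0) (m : ℕ) :
    ∃ C D : ℝ, 0 ≤ C ∧ 0 ≤ D ∧ ∀ n, partitionSum a n m ≠ 0 → ∀ k ≥ 1,
      ‖partitionSum a n (m + k)‖ ≤ D * (C * ((n : ℝ) + 1) ^ 2) ^ k * ‖partitionSum a n m‖ := by
  rcases eq_or_ne (a 2) 0 with ha2 | ha2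
  · refine ⟨0, 0, le_rfl, le_rfl, fun n _ k hk => ?_⟩
    rw [partitionSum_eq_zero_of_forall_eq_zero (ha ha2) n (by omega)]
    simp
  have hlarge : ∃ C D : ℝ, 1 ≤ C ∧ 0 ≤ D ∧ ∀ᶠ n : ℕ in atTop, partitionSum a n m ≠ 0 → ∀ k ≥ 1,
      ‖partitionSum a n (m + k)‖ ≤ D * (C * ((n : ℝ) + 1) ^ 2) ^ k * ‖partitionSum a n m‖ := by
    rcases eq_or_ne (a 1) 0 with ha1 | ha1
    · -- `W(n, m)` vanishes for large `n`, so that nothing is claimed there.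
      refine ⟨1, 0, le_rfl, le_rfl, ?_⟩
      filter_upwards [eventually_gt_atTop (2 * m)] with n hn h
      exact absurd (partitionSum_eq_zero_of_one_eq_zero ha1 hn) h
    obtain ⟨C, hC1, hC⟩ := exists_norm_partitionSum_le ha1 hK0 hK
    obtain ⟨c, hc, h⟩ := exists_le_norm_normalized_partitionSum ha1 ha2 m
    refine ⟨C, C ^ m / c, hC1, by positivity, ?_⟩
    filter_upwards [h, eventually_ge_atTop 1] with n hn hn1 _ k _
    set N : ℝ := ‖(n.factorial : ℂ)‖ / ‖a 1 ^ n‖ with hN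
    have hN0 : 0 < N := div_pos (norm_pos_iff.2 (Nat.cast_ne_zero.2 (Nat.factorial_ne_zero _)))
      (norm_pos_iff.2 (pow_ne_zero _ ha1))
    have hnorm : ∀ j, ‖(n.factorial : ℂ) * partitionSum a n j / a 1 ^ n‖
        = N * ‖partitionSum a n j‖ := fun j => by
      rw [norm_div, norm_mul, hN]; ring
    have hup := hC n hn1 (m + k)
    rw [hnorm] at hn hup
    have hn' : ((n : ℝ) ^ 2) ^ m ≤ N * ‖partitionSum a n m‖ / c := by
      rw [le_div_iff₀ hc]; linarith
    refine le_of_mul_le_mul_left ?_ hN0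
    calc N * ‖partitionSum a n (m + k)‖ ≤ (C * (n : ℝ) ^ 2) ^ (m + k) := hup
      _ = C ^ m * (C * (n : ℝ) ^ 2) ^ k * ((n : ℝ) ^ 2) ^ m := by
          rw [pow_add, mul_pow C]; ring
      _ ≤ C ^ m * (C * ((n : ℝ) + 1) ^ 2) ^ k * (N * ‖partitionSum a n m‖ / c) := by
          gcongr
          linarith
      _ = _ := by ring
  obtain ⟨C, D, hC, hD, h⟩ := hlarge
  obtain ⟨M, hM⟩ := eventually_atTop.1 h
  have hsmall : ∀ n, ∃ F : ℝ, 0 ≤ F ∧ (partitionSum a n m ≠ 0 → ∀ k,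
      ‖partitionSum a n (m + k)‖ ≤ F * ‖partitionSum a n m‖) := by
    intro n
    refine ⟨(∑ j ∈ range (n + 1), ‖partitionSum a n j‖) / ‖partitionSum a n m‖, by positivity,
      fun hn k => ?_⟩
    rw [div_mul_cancel₀ _ (norm_ne_zero_iff.2 hn)]
    rcases lt_or_ge n (m + k) with hnk | hnk
    · rw [partitionSum_eq_zero_of_lt a hnk, norm_zero]
      exact sum_nonneg fun _ _ => norm_nonneg _
    · exact single_le_sum (f := fun j => ‖partitionSum a n j‖) (fun _ _ => norm_nonneg _)
        (mem_range.2 (by omega : m + k < n + 1))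
  choose F hF0 hF using hsmall
  refine ⟨C, D + ∑ n ∈ range M, F n, by linarith, add_nonneg hD (sum_nonneg fun n _ => hF0 n),
    fun n hn k hk => ?_⟩
  rcases le_or_gt M n with hMn | hMn
  · refine (hM n hMn hn k hk).trans ?_
    have : 0 ≤ ∑ n ∈ range M, F n := sum_nonneg fun n _ => hF0 n
    gcongr
    linarith
  have hone : 1 ≤ (C * ((n : ℝ) + 1) ^ 2) ^ k := by
    refine one_le_pow₀ (one_le_mul_of_one_le_of_one_le hC (one_le_pow₀ ?_))
    have : (0 : ℝ) ≤ n := n.cast_nonneg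
    linarith
  have hFD : F n ≤ D + ∑ n ∈ range M, F n := by
    have := single_le_sum (f := fun n => F n) (fun j _ => hF0 j) (mem_range.2 hMn)
    linarith
  refine (hF n hn k).trans (mul_le_mul_of_nonneg_right ?_ (norm_nonneg _))
  exact hFD.trans (le_mul_of_one_le_right ((hF0 n).trans hFD) hone)

/-! ### Truncation of the expansion -/

theorem fallFactorial_natCast {N j : ℕ} (hj : j ≤ N) :
    fallFactorial (N : ℂ) j = (N.descFactorial j : ℂ) := by
  induction j with
  | zero => simp [fallFactorial, genFactorial]
  | succ j ih =>
    rw [fallFactorial, genFactorial_succ, ← fallFactorial, ih (by omega),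
      Nat.descFactorial_succ, Nat.cast_mul, Nat.cast_sub (by omega)]
    ring

/-- The falling factorial `[μ - n + j]_j` that occurs in the expansions is `(d + 1) ⋯ (d + j)` with
`d = μ - n`. -/
theorem fallFactorial_natCast_add (d j : ℕ) :
    fallFactorial ((d : ℂ) + j) j = ((d + 1).ascFactorial j : ℂ) := by
  rw [← Nat.cast_add, fallFactorial_natCast (by omega), Nat.add_descFactorial_eq_ascFactorial]

theorem pow_mul_ascFactorial_le (d m k : ℕ) :
    d ^ k * (d + 1).ascFactorial m ≤ (d + 1).ascFactorial (m + k) := by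
  rw [← Nat.ascFactorial_mul_ascFactorial, mul_comm]
  refine Nat.mul_le_mul_left _ ?_
  exact (Nat.pow_le_pow_left (by omega) k).trans (Nat.pow_succ_le_ascFactorial (d + 1 + m) k)

theorem partialExpansion_natCast_add (a : ℕ → ℂ) (q : ℂ) (m n d : ℕ) :
    partialExpansion a q m n (n + d) = ∑ j ∈ range (m + 1), q ^ j *
      (partitionSum a n j / ((d + 1).ascFactorial j : ℂ)) := by
  rw [partialExpansion]
  refine sum_congr rfl fun j _ => ?_
  rw [← fallFactorial_natCast_add]
  push_cast
  ring_nf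

/-- If `n ≤ m`, then both sides vanish because `W(n, j) = 0` for `j > n`. -/
theorem partialExpansion_sub (a : ℕ → ℂ) (q : ℂ) (m n d : ℕ) :
    partialExpansion a q n n (n + d) - partialExpansion a q m n (n + d)
      = ∑ k ∈ range (n - m), q ^ (m + 1 + k) *
        (partitionSum a n (m + 1 + k) / ((d + 1).ascFactorial (m + 1 + k) : ℂ)) := by
  rw [partialExpansion_natCast_add, partialExpansion_natCast_add, sub_eq_iff_eq_add',
    ← sum_range_add]
  refine sum_subset (range_subset_range.2 (by omega)) fun j _ hj => ?_
  rw [partitionSum_eq_zero_of_lt a (by rw [mem_range] at hj; omega)]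
  simp

/-- The discarded terms, relative to the last one kept, are dominated by a geometric series with
ratio `‖q‖ C (n + 1) ^ 2 / d`, where `d = μ - n`. -/
theorem norm_partialExpansion_sub_le {a : ℕ → ℂ} {q : ℂ} {m n d : ℕ} {C D : ℝ} (hC : 0 ≤ C)
    (hD : 0 ≤ D) (hd : d ≠ 0)
    (h : ∀ k ≥ 1, ‖partitionSum a n (m + k)‖
      ≤ D * (C * ((n : ℝ) + 1) ^ 2) ^ k * ‖partitionSum a n m‖)
    (hx : ‖q‖ * C * (((n : ℝ) + 1) ^ 2 / d) ≤ 1 / 2) :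
    ‖partialExpansion a q n n (n + d) - partialExpansion a q m n (n + d)‖
      ≤ 2 * ‖q‖ ^ m * D * (‖q‖ * C * (((n : ℝ) + 1) ^ 2 / d)) *
        (‖partitionSum a n m‖ / (d + 1).ascFactorial m) := by
  set x : ℝ := ‖q‖ * C * (((n : ℝ) + 1) ^ 2 / d) with hxdef
  have hx0 : 0 ≤ x := by positivity
  have hd0 : (0 : ℝ) < d := by positivity
  set w : ℝ := ‖partitionSum a n m‖ / (d + 1).ascFactorial m with hw
  have hA : (0 : ℝ) < (d + 1).ascFactorial m := by exact_mod_cast Nat.ascFactorial_pos d m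
  have hterm : ∀ k, ‖q ^ (m + 1 + k) *
      (partitionSum a n (m + 1 + k) / ((d + 1).ascFactorial (m + 1 + k) : ℂ))‖
      ≤ ‖q‖ ^ m * D * x * w * x ^ k := by
    intro k
    rw [norm_mul, norm_div, norm_pow, Complex.norm_natCast, add_assoc]
    have h1 := h (1 + k) (by omega)
    have h2 : (d : ℝ) ^ (1 + k) * (d + 1).ascFactorial m ≤ (d + 1).ascFactorial (m + (1 + k)) := by
      exact_mod_cast pow_mul_ascFactorial_le d m (1 + k)
    calc _ ≤ ‖q‖ ^ (m + (1 + k)) * ((D * (C * ((n : ℝ) + 1) ^ 2) ^ (1 + k) * ‖partitionSum a n m‖)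
          / ((d : ℝ) ^ (1 + k) * (d + 1).ascFactorial m)) := by gcongr
      _ = ‖q‖ ^ m * D * x ^ (1 + k) * w := by
          rw [hxdef, hw, pow_add ‖q‖ m, mul_pow _ (((n : ℝ) + 1) ^ 2 / d), mul_pow ‖q‖ C, div_pow,
            mul_pow C]
          field_simp
      _ = _ := by rw [pow_add, pow_one]; ring
  rw [partialExpansion_sub]
  refine (norm_sum_le_of_le _ fun k _ => hterm k).trans ?_
  rw [← mul_sum]
  have hgeom : ∑ k ∈ range (n - m), x ^ k ≤ 2 := by
    refine (sum_le_sum fun k _ => ?_).trans (sum_geometric_two_le (n - m))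
    exact pow_le_pow_left₀ hx0 hx k
  have hnn : 0 ≤ ‖q‖ ^ m * D * x * w := by positivity
  calc _ ≤ ‖q‖ ^ m * D * x * w * 2 := by gcongr
    _ = _ := by ring

theorem tendsto_sq_div_sub {ι : Type*} {l : Filter ι} {n μ : ι → ℕ} (hμ : Tendsto μ l atTop)
    (hn : (fun i => (n i : ℝ)) =o[l] (fun i => Real.sqrt (μ i))) :
    Tendsto (fun i => ((n i : ℝ) + 1) ^ 2 / ((μ i : ℝ) - n i)) l (nhds 0) := by
  have hu := hn.tendsto_div_nhds_zero
  have hv : Tendsto (fun i => (Real.sqrt (μ i))⁻¹) l (nhds 0) :=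
    tendsto_inv_atTop_zero.comp (Real.tendsto_sqrt_atTop.comp
      (tendsto_natCast_atTop_atTop.comp hμ))
  -- Numerator and denominator are divided by `μ`.
  have h := ((hu.add hv).pow 2).div ((tendsto_const_nhds (x := (1 : ℝ))).sub (hu.mul hv))
    (by norm_num)
  norm_num at h
  refine h.congr' ?_
  filter_upwards [hμ.eventually_gt_atTop 0] with i hi
  have hi : (0 : ℝ) < μ i := by exact_mod_cast hi
  have hs : Real.sqrt (μ i) ≠ 0 := (Real.sqrt_pos.2 hi).ne'
  have hsq : (μ i : ℝ) = Real.sqrt (μ i) ^ 2 := (Real.sq_sqrt hi.le).symm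
  simp only [Pi.div_apply]
  rw [inv_eq_one_div, ← add_div, div_pow, ← hsq, div_mul_div_comm, mul_one, ← sq, ← hsq,
    one_sub_div hi.ne', div_div_div_cancel_right₀ hi.ne']

theorem eventually_lt_of_isLittleO_sqrt {ι : Type*} {l : Filter ι} {n μ : ι → ℕ}
    (hμ : Tendsto μ l atTop) (hn : (fun i => (n i : ℝ)) =o[l] (fun i => Real.sqrt (μ i))) :
    ∀ᶠ i in l, n i < μ i := by
  filter_upwards [hn.bound (show (0 : ℝ) < 1 / 2 by norm_num), hμ.eventually_ge_atTop 1] with i h hi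
  rw [Real.norm_natCast, Real.norm_of_nonneg (Real.sqrt_nonneg _)] at h
  have hi : (1 : ℝ) ≤ μ i := by exact_mod_cast hi
  have h1 : Real.sqrt (μ i) ≤ μ i := Real.sqrt_le_iff.2 ⟨by linarith, by nlinarith⟩
  have : (n i : ℝ) < μ i := by linarith
  exact_mod_cast this

theorem isLittleO_partialExpansion_sub {a : ℕ → ℂ} {K : ℝ} (hK0 : 0 ≤ K)
    (hK : ∀ i ≥ 1, ‖a (i + 1)‖ ≤ K ^ i) (ha : a 2 = 0 → ∀ j ≥ 2, a j = 0) (q : ℂ) (m : ℕ)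
    {ι : Type*} {l : Filter ι} {n μ : ι → ℕ} (hμ : Tendsto μ l atTop)
    (hn : (fun i => (n i : ℝ)) =o[l] (fun i => Real.sqrt (μ i)))
    (hW : ∀ᶠ i in l, partitionSum a (n i) m = 0 → ∀ j > m, partitionSum a (n i) j = 0) :
    (fun i => partialExpansion a q (n i) (n i) (μ i) - partialExpansion a q m (n i) (μ i))
      =o[l] (fun i => partitionSum a (n i) m / fallFactorial ((μ i : ℂ) - n i + m) m) := by
  obtain ⟨C, D, hC, hD, h⟩ := exists_norm_partitionSum_add_le hK0 hK ha m
  have hx := (tendsto_sq_div_sub hμ hn).const_mul (‖q‖ * C)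
  have hy := hx.const_mul (2 * ‖q‖ ^ m * D)
  rw [mul_zero] at hx
  rw [mul_zero, mul_zero] at hy
  refine isLittleO_iff.2 fun c hc => ?_
  filter_upwards [eventually_lt_of_isLittleO_sqrt hμ hn, hW,
    hx.eventually_le_const (show (0 : ℝ) < 1 / 2 by norm_num), hy.eventually_le_const hc]
    with i hi hWi hxi hyi
  obtain ⟨d, hd⟩ := Nat.exists_eq_add_of_le hi.le
  rw [hd] at hxi hyi ⊢
  have hd0 : d ≠ 0 := by omega
  have hcast : (((n i + d : ℕ) : ℂ) - n i + m) = (d : ℂ) + m := by push_cast; ring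
  have hcast' : (((n i + d : ℕ) : ℝ) - n i) = d := by push_cast; ring
  rw [hcast'] at hxi hyi
  rw [hcast, fallFactorial_natCast_add]
  rcases eq_or_ne (partitionSum a (n i) m) 0 with h0 | h0
  · -- All discarded terms vanish by hypothesis.
    rw [partialExpansion_sub, sum_eq_zero fun k _ => by
      rw [hWi h0 (m + 1 + k) (by omega), zero_div, mul_zero], norm_zero]
    positivity
  · refine (norm_partialExpansion_sub_le hC hD hd0 (h _ h0) hxi).trans ?_
    rw [norm_div, Complex.norm_natCast]
    gcongr

theorem isBigO_partialExpansion_sub (a : ℕ → ℂ) (q : ℂ) (m n : ℕ) :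
    (fun M : ℕ => partialExpansion a q n n M - partialExpansion a q m n M)
      =O[atTop] (fun M : ℕ => ((M : ℂ) ^ (m + 1))⁻¹) := by
  have h : (fun M : ℕ => ∑ k ∈ range (n - m), q ^ (m + 1 + k) *
      (partitionSum a n (m + 1 + k) / ((M - n + 1).ascFactorial (m + 1 + k) : ℂ)))
      =O[atTop] (fun M : ℕ => ((M : ℂ) ^ (m + 1))⁻¹) := by
    refine IsBigO.fun_sum fun k _ => ?_
    refine IsBigO.of_bound (‖q ^ (m + 1 + k) * partitionSum a n (m + 1 + k)‖
      * ((n : ℝ) + 1) ^ (m + 1)) ?_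
    filter_upwards [eventually_ge_atTop (n + 1)] with M hM
    obtain ⟨d, rfl⟩ := Nat.exists_eq_add_of_le (show n ≤ M by omega)
    rw [Nat.add_sub_cancel_left, ← mul_div_assoc, norm_div, norm_inv, norm_pow ((n + d : ℕ) : ℂ),
      Complex.norm_natCast, Complex.norm_natCast, div_eq_mul_inv, mul_assoc]
    have h1 : ((n + d : ℕ) : ℝ) ^ (m + 1)
        ≤ ((n : ℝ) + 1) ^ (m + 1) * (d + 1).ascFactorial (m + 1 + k) := by
      have h2 : (((d : ℝ) + 1) ^ (m + 1)) ≤ (d + 1).ascFactorial (m + 1 + k) := by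
        have h3 := Nat.pow_succ_le_ascFactorial (d + 1) (m + 1 + k)
        have h4 := Nat.pow_le_pow_right (show 0 < d + 1 by omega) (show m + 1 ≤ m + 1 + k by omega)
        exact_mod_cast h4.trans h3
      -- With `M = n + d`, the comparison of `M` with `d + 1` costs a factor `n + 1`.
      calc ((n + d : ℕ) : ℝ) ^ (m + 1) ≤ (((n : ℝ) + 1) * ((d : ℝ) + 1)) ^ (m + 1) := by
            gcongr
            push_cast
            have : (0 : ℝ) ≤ n * d := by positivity
            linarith
        _ ≤ _ := by rw [mul_pow]; gcongr
    have hA : (0 : ℝ) < (d + 1).ascFactorial (m + 1 + k) := by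
      exact_mod_cast Nat.ascFactorial_pos d _
    have hM : (0 : ℝ) < ((n + d : ℕ) : ℝ) := by exact_mod_cast (by omega : 0 < n + d)
    gcongr
    rw [inv_le_iff_one_le_mul₀ hA, mul_right_comm, ← div_eq_mul_inv, le_div_iff₀ (by positivity),
      one_mul]
    exact h1
  refine h.congr' ?_ EventuallyEq.rfl
  filter_upwards [eventually_ge_atTop n] with M hM
  obtain ⟨d, rfl⟩ := Nat.exists_eq_add_of_le hM
  rw [partialExpansion_sub, Nat.add_sub_cancel_left]

/-! ### The exact expansions -/

/-- The expansion is exact once all terms are kept: up to the factor `[μ]_n a_0 ^ (μ - n)`, the sum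
`partialExpansion` with `m = n` is the coefficient of `t ^ n` in the `μ`-th power of
`∑_j a_j t ^ j`. Here `μ = n + d`. -/
theorem coeff_mk_pow (a : ℕ → ℂ) (n d : ℕ) :
    PowerSeries.coeff n (PowerSeries.mk a ^ (n + d))
      = ((n + d).descFactorial n : ℂ) * (a 0 ^ d * partialExpansion a (a 0) n n (n + d)) := by
  set B : PowerSeries ℂ := PowerSeries.mk fun i => if i = 0 then 0 else a i with hB
  have hA : PowerSeries.mk a = B + PowerSeries.C (a 0) := by
    ext i
    cases i <;> simp [hB]
  have hX : PowerSeries.X ∣ B := by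
    rw [PowerSeries.X_dvd_iff]
    simp [hB]
  rw [hA, add_pow, map_sum, ← sum_subset (s₁ := range (n + 1)) (range_subset_range.2 (by omega)),
    ← sum_range_reflect, partialExpansion_natCast_add, mul_sum, mul_sum]
  · refine sum_congr rfl fun j hj => ?_
    have hj : j ≤ n := Nat.lt_succ_iff.1 (mem_range.1 hj)
    rw [show n + 1 - 1 - j = n - j by omega, show n + d - (n - j) = d + j by omega, ← map_pow,
      ← map_natCast (PowerSeries.C (R := ℂ)), mul_assoc, ← map_mul, PowerSeries.coeff_mul_C,
      ← factorial_mul_partitionSum a (Nat.sub_add_cancel hj)]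
    have h1 := Nat.descFactorial_mul_descFactorial (n := n + d) (show n - j ≤ n by omega)
    rw [show n + d - (n - j) = d + j by omega, show n - (n - j) = j by omega,
      Nat.add_descFactorial_eq_ascFactorial, Nat.descFactorial_eq_factorial_mul_choose _ (n - j)]
      at h1
    rw [← h1]
    have h2 : ((d + 1).ascFactorial j : ℂ) ≠ 0 :=
      Nat.cast_ne_zero.2 (Nat.ascFactorial_pos d j).ne'
    push_cast
    field_simp
    ring
  · intro k _ hk
    have hk : n < k := by rw [mem_range] at hk; omega
    rw [← map_pow, ← map_natCast (PowerSeries.C (R := ℂ)), mul_assoc, ← map_mul,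
      PowerSeries.coeff_mul_C, PowerSeries.X_pow_dvd_iff.1 (pow_dvd_pow_of_dvd hX k) n hk, zero_mul]

theorem mk_coeffExp (α β r : ℂ) (ε : ℝ) :
    PowerSeries.mk (coeffExp α β r ε) = PowerSeries.C β⁻¹ *
      (PowerSeries.C (Complex.exp ε) * genFactorialSeries (-α) (r + β)
        - genFactorialSeries (-α) r) := by
  ext j
  rw [PowerSeries.coeff_mk, PowerSeries.coeff_C_mul, map_sub, PowerSeries.coeff_C_mul,
    genFactorialSeries, genFactorialSeries, PowerSeries.coeff_mk, PowerSeries.coeff_mk, coeffExp]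
  have h2 : (j.factorial : ℂ) ≠ 0 := Nat.cast_ne_zero.2 (Nat.factorial_ne_zero _)
  field_simp

/-- At `ε = 0` the constant term `a_0` vanishes, and the sequence is shifted by one. -/
theorem X_mul_mk_coeffZero (α β r : ℂ) :
    PowerSeries.X * PowerSeries.mk (coeffZero α β r) = PowerSeries.mk (coeffExp α β r 0) := by
  ext j
  cases j with
  | zero => simp [coeffExp, genFactorial]
  | succ j => simp [PowerSeries.coeff_succ_X_mul, coeffExp, coeffZero]

theorem genStirlingFunction_mul_eq (α β r : ℂ) (ε : ℝ) (n μ : ℕ) :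
    genStirlingFunction n μ α β ((μ : ℂ) * r) ε = (n.factorial : ℂ) / (μ.factorial : ℂ) *
      PowerSeries.coeff n (PowerSeries.mk (coeffExp α β r ε) ^ μ) := by
  rw [genStirlingFunction, genDifference_genFactorial, mk_coeffExp, mul_pow, ← map_pow,
    PowerSeries.coeff_C_mul, inv_pow]
  field_simp

/-- Exact form of the expansion of the generalized Stirling functions. -/
theorem genStirlingFunction_expansion (α β r : ℂ) (ε : ℝ) {n μ : ℕ} (h : n ≤ μ) :
    (μ.factorial : ℂ) * genStirlingFunction n μ α β ((μ : ℂ) * r) ε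
        / (fallFactorial (μ : ℂ) n * (n.factorial : ℂ))
      = (β / (Complex.exp ε - 1)) ^ ((n : ℤ) - (μ : ℤ)) *
        partialExpansion (coeffExp α β r ε) ((Complex.exp ε - 1) / β) n n μ := by
  obtain ⟨d, rfl⟩ := Nat.exists_eq_add_of_le h
  have h0 : coeffExp α β r ε 0 = (Complex.exp ε - 1) / β := by simp [coeffExp, genFactorial]
  have h1 : ((n + d).descFactorial n : ℂ) ≠ 0 :=
    Nat.cast_ne_zero.2 (Nat.descFactorial_pos.2 h).ne'
  have h2 : (n.factorial : ℂ) ≠ 0 := Nat.cast_ne_zero.2 (Nat.factorial_ne_zero _)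
  have h3 : ((n + d).factorial : ℂ) ≠ 0 := Nat.cast_ne_zero.2 (Nat.factorial_ne_zero _)
  have hz : (β / (Complex.exp ε - 1)) ^ ((n : ℤ) - ((n + d : ℕ) : ℤ))
      = ((Complex.exp ε - 1) / β) ^ d := by
    rw [show (n : ℤ) - ((n + d : ℕ) : ℤ) = -(d : ℤ) by push_cast; ring, zpow_neg, zpow_natCast,
      ← inv_pow, inv_div]
  rw [hz, genStirlingFunction_mul_eq, coeff_mk_pow, h0, fallFactorial_natCast h]
  field_simp

/-- Exact form of the expansion of the generalized Stirling numbers. -/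
theorem genStirlingNumber_expansion (α r : ℂ) {β : ℂ} (hβ : β ≠ 0) {n μ : ℕ} (h : n ≤ μ) :
    genStirlingNumber (n + μ) μ α β ((μ : ℂ) * r)
        / (fallFactorial (μ : ℂ) n * fallFactorial ((n : ℂ) + μ) n)
      = partialExpansion (coeffZero α β r) 1 n n μ := by
  have h0 : coeffZero α β r 0 = 1 := by simp [coeffZero, genFactorial, hβ]
  have h1 : (μ.descFactorial n : ℂ) ≠ 0 :=
    Nat.cast_ne_zero.2 (Nat.descFactorial_pos.2 h).ne'
  have h2 : (((n + μ).descFactorial n : ℕ) : ℂ) ≠ 0 :=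
    Nat.cast_ne_zero.2 (Nat.descFactorial_pos.2 (by omega)).ne'
  have h3 : (μ.factorial : ℂ) ≠ 0 := Nat.cast_ne_zero.2 (Nat.factorial_ne_zero _)
  have h4 := Nat.factorial_mul_descFactorial (show n ≤ n + μ by omega)
  rw [Nat.add_sub_cancel_left] at h4
  rw [genStirlingNumber_eq_genStirlingFunction _ _ _ _ hβ (by omega), genStirlingFunction_mul_eq,
    ← X_mul_mk_coeffZero, mul_pow, PowerSeries.coeff_X_pow_mul, ← Nat.cast_add,
    fallFactorial_natCast h, fallFactorial_natCast (by omega), ← h4]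
  obtain ⟨d, rfl⟩ := Nat.exists_eq_add_of_le h
  rw [coeff_mk_pow, h0]
  push_cast
  field_simp
  simp

/-! ### Geometric growth of the coefficient sequences -/

theorem norm_genFactorial_div_factorial_le (z c : ℂ) (n : ℕ) :
    ‖genFactorial z n c / (n.factorial : ℂ)‖ ≤ (‖z‖ + ‖c‖) ^ n := by
  induction n with
  | zero => simp [genFactorial]
  | succ n ih =>
    have h : genFactorial z (n + 1) c / ((n + 1).factorial : ℂ)
        = genFactorial z n c / (n.factorial : ℂ) * ((z + n * c) / ((n + 1 : ℕ) : ℂ)) := by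
      rw [genFactorial_succ, Nat.factorial_succ, Nat.cast_mul]
      have h2 : (n.factorial : ℂ) ≠ 0 := Nat.cast_ne_zero.2 (Nat.factorial_ne_zero _)
      have h3 : ((n + 1 : ℕ) : ℂ) ≠ 0 := Nat.cast_ne_zero.2 n.succ_ne_zero
      field_simp
    rw [h, norm_mul, pow_succ]
    refine mul_le_mul ih ?_ (norm_nonneg _) (by positivity)
    rw [norm_div, Complex.norm_natCast, div_le_iff₀ (by positivity)]
    refine (norm_add_le _ _).trans ?_
    rw [norm_mul, Complex.norm_natCast]
    push_cast
    have : 0 ≤ (n : ℝ) * ‖z‖ := by positivity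
    have := norm_nonneg c
    linarith

/-- The form of the geometric bound that `norm_coeff_pow_le` requires of the series
`∑_{i ≥ 1} a_{i+1} t ^ i`: without a constant in front. -/
theorem exists_pow_bound_of_geometric {a : ℕ → ℂ} {C R : ℝ} (h : ∀ j, ‖a j‖ ≤ C * R ^ j)
    (hC : 0 ≤ C) (hR : 0 ≤ R) : ∃ K : ℝ, 0 ≤ K ∧ ∀ i ≥ 1, ‖a (i + 1)‖ ≤ K ^ i := by
  refine ⟨(1 + C) * (1 + R) ^ 2, by positivity, fun i hi => ?_⟩
  calc ‖a (i + 1)‖ ≤ C * R ^ (i + 1) := h _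
    _ ≤ (1 + C) ^ i * (1 + R) ^ (2 * i) := by
        have h1 : C ≤ (1 + C) ^ i :=
          (by linarith : C ≤ 1 + C).trans (le_self_pow₀ (by linarith) (by omega))
        have h2 : R ^ (i + 1) ≤ (1 + R) ^ (2 * i) :=
          (pow_le_pow_left₀ hR (by linarith) _).trans
            (pow_le_pow_right₀ (by linarith) (by omega))
        exact mul_le_mul h1 h2 (by positivity) (by positivity)
    _ = _ := by rw [mul_pow, pow_mul]

theorem norm_coeffExp_le (α β r : ℂ) (ε : ℝ) (j : ℕ) : ‖coeffExp α β r ε j‖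
    ≤ (‖Complex.exp ε‖ + 1) * ‖β‖⁻¹ * (‖r‖ + ‖β‖ + ‖α‖) ^ j := by
  have h1 := norm_genFactorial_div_factorial_le (r + β) (-α) j
  have h2 := norm_genFactorial_div_factorial_le r (-α) j
  rw [norm_neg] at h1 h2
  have h3 : coeffExp α β r ε j = (Complex.exp ε * (genFactorial (r + β) j (-α) / (j.factorial : ℂ))
      - genFactorial r j (-α) / (j.factorial : ℂ)) * β⁻¹ := by
    rw [coeffExp]
    have h2 : (j.factorial : ℂ) ≠ 0 := Nat.cast_ne_zero.2 (Nat.factorial_ne_zero _)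
    field_simp
  have h4 : (‖r + β‖ + ‖α‖) ^ j ≤ (‖r‖ + ‖β‖ + ‖α‖) ^ j := by
    gcongr
    exact norm_add_le _ _
  have h5 : (‖r‖ + ‖α‖) ^ j ≤ (‖r‖ + ‖β‖ + ‖α‖) ^ j := by
    gcongr
    linarith [norm_nonneg β]
  rw [h3, norm_mul, norm_inv, mul_right_comm]
  gcongr
  refine (norm_sub_le _ _).trans ?_
  rw [norm_mul, add_mul, one_mul]
  gcongr
  · exact h1.trans h4
  · exact h2.trans h5

theorem norm_coeffZero_le (α β r : ℂ) (j : ℕ) : ‖coeffZero α β r j‖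
    ≤ 2 * ‖β‖⁻¹ * (‖r‖ + ‖β‖ + ‖α‖) * (‖r‖ + ‖β‖ + ‖α‖) ^ j := by
  have h := norm_coeffExp_le α β r 0 (j + 1)
  rw [← PowerSeries.coeff_mk (R := ℂ) (j + 1) (coeffExp α β r 0), ← X_mul_mk_coeffZero,
    PowerSeries.coeff_succ_X_mul, PowerSeries.coeff_mk] at h
  refine h.trans_eq ?_
  rw [Complex.ofReal_zero, Complex.exp_zero, norm_one, pow_succ]
  ring

/-! ### The asymptotic expansions -/

theorem mainTheorem5 (α β r : ℂ) (hβ : β ≠ 0) (m : ℕ)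
    {ι : Type*} (l : Filter ι) (n μ : ι → ℕ) (hμ : Tendsto μ l atTop)
    (hn : (fun i => (n i : ℝ)) =o[l] (fun i => Real.sqrt (μ i))) :
    (∀ ε : ℝ, ε ≠ 0 →
      (coeffExp α β r ε 1 ≠ 0 → coeffExp α β r ε 2 ≠ 0 →
        ∀ᶠ N in atTop, partitionSum (coeffExp α β r ε) N m ≠ 0) ∧
      ((coeffExp α β r ε 2 = 0 → ∀ j ≥ 2, coeffExp α β r ε j = 0) →
        (∀ᶠ i in l, partitionSum (coeffExp α β r ε) (n i) m = 0 →
          ∀ j > m, partitionSum (coeffExp α β r ε) (n i) j = 0) →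
          (fun i =>
              ((μ i).factorial : ℂ) * genStirlingFunction (n i) (μ i) α β ((μ i : ℂ) * r) ε
                / (fallFactorial (μ i : ℂ) (n i) * ((n i).factorial : ℂ))
              - (β / (Complex.exp ε - 1)) ^ ((n i : ℤ) - (μ i : ℤ))
                * partialExpansion (coeffExp α β r ε) ((Complex.exp ε - 1) / β) m (n i) (μ i))
            =o[l] (fun i =>
              (β / (Complex.exp ε - 1)) ^ ((n i : ℤ) - (μ i : ℤ))
                * (partitionSum (coeffExp α β r ε) (n i) m
                  / fallFactorial ((μ i : ℂ) - n i + m) m))) ∧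
      ∀ N : ℕ,
        (fun M : ℕ =>
            (M.factorial : ℂ) * genStirlingFunction N M α β ((M : ℂ) * r) ε
              / (fallFactorial (M : ℂ) N * (N.factorial : ℂ))
            - (β / (Complex.exp ε - 1)) ^ ((N : ℤ) - (M : ℤ))
              * partialExpansion (coeffExp α β r ε) ((Complex.exp ε - 1) / β) m N M)
          =O[atTop] (fun M : ℕ =>
            (β / (Complex.exp ε - 1)) ^ ((N : ℤ) - (M : ℤ)) * ((M : ℂ) ^ (m + 1))⁻¹)) ∧
    ((coeffZero α β r 1 ≠ 0 → coeffZero α β r 2 ≠ 0 →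
        ∀ᶠ N in atTop, partitionSum (coeffZero α β r) N m ≠ 0) ∧
      ((coeffZero α β r 2 = 0 → ∀ j ≥ 2, coeffZero α β r j = 0) →
        (∀ᶠ i in l, partitionSum (coeffZero α β r) (n i) m = 0 →
          ∀ j > m, partitionSum (coeffZero α β r) (n i) j = 0) →
          (fun i =>
              genStirlingNumber (n i + μ i) (μ i) α β ((μ i : ℂ) * r)
                / (fallFactorial (μ i : ℂ) (n i) * fallFactorial ((n i : ℂ) + μ i) (n i))
              - partialExpansion (coeffZero α β r) 1 m (n i) (μ i))
            =o[l] (fun i =>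
              partitionSum (coeffZero α β r) (n i) m
                / fallFactorial ((μ i : ℂ) - n i + m) m)) ∧
      ∀ N : ℕ,
        (fun M : ℕ =>
            genStirlingNumber (N + M) M α β ((M : ℂ) * r)
              / (fallFactorial (M : ℂ) N * fallFactorial ((N : ℂ) + M) N)
            - partialExpansion (coeffZero α β r) 1 m N M)
          =O[atTop] (fun M : ℕ => ((M : ℂ) ^ (m + 1))⁻¹)) := by
  refine ⟨fun ε _ => ?_, ?_⟩
  · obtain ⟨K, hK0, hK⟩ := exists_pow_bound_of_geometric (norm_coeffExp_le α β r ε)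
      (by positivity) (by positivity)
    refine ⟨fun h1 h2 => eventually_partitionSum_ne_zero h1 h2 m, fun ha hW => ?_, fun N => ?_⟩
    · refine ((isBigO_refl _ l).mul_isLittleO (isLittleO_partialExpansion_sub hK0 hK ha
        ((Complex.exp ε - 1) / β) m hμ hn hW)).congr' ?_ EventuallyEq.rfl
      filter_upwards [eventually_lt_of_isLittleO_sqrt hμ hn] with i hi
      rw [genStirlingFunction_expansion α β r ε hi.le, mul_sub]
    · refine ((isBigO_refl _ atTop).mul (isBigO_partialExpansion_sub (coeffExp α β r ε)
        ((Complex.exp ε - 1) / β) m N)).congr' ?_ EventuallyEq.rfl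
      filter_upwards [eventually_ge_atTop N] with M hM
      rw [genStirlingFunction_expansion α β r ε hM, mul_sub]
  · obtain ⟨K, hK0, hK⟩ := exists_pow_bound_of_geometric (norm_coeffZero_le α β r)
      (by positivity) (by positivity)
    refine ⟨fun h1 h2 => eventually_partitionSum_ne_zero h1 h2 m, fun ha hW => ?_, fun N => ?_⟩
    · refine (isLittleO_partialExpansion_sub hK0 hK ha 1 m hμ hn hW).congr' ?_ EventuallyEq.rfl
      filter_upwards [eventually_lt_of_isLittleO_sqrt hμ hn] with i hi
      rw [genStirlingNumber_expansion α r hβ hi.le]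
    · refine (isBigO_partialExpansion_sub (coeffZero α β r) 1 m N).congr' ?_ EventuallyEq.rfl
      filter_upwards [eventually_ge_atTop N] with M hM
      rw [genStirlingNumber_expansion α r hβ hM]
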